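/- Let $\mathbf{k}$ be an algebraically closed field of characteristic zero, let $X$ be an irreducible smooth affine variety over $\mathbf{k}$, let $\mathcal{A}=\mathcal{O}(X)$ be its algebra of regular functions and let $\mathcal{V}=\operatorname{Der}_{\mathbf{k}}(\mathcal{A})$ be the Lie algebra of vector fields on $X$. An $\mathcal{A}\mathcal{V}$ module is a $\mathbf{k}$-vector space $M$ that is both a module over the commutative algebra $\mathcal{A}$ and a module over the Lie algebra $\mathcal{V}$, such that $$\eta(fm)=f(\eta m)+\eta(f)m\qquad\text{for all }\eta\in\mathcal{V},\ f\in\mathcal{A},\ m\in M.$$ Let $M$ be an $\mathcal{A}\mathcal{V}$ module that is finitely generated as an $\mathcal{A}$ module. Then the torsion submodule $$\operatorname{Tor}_{\mathcal{A}}(M)=\{m\in M \mid \exists f\in\mathcal{A},\ f\neq 0,\ fm=0\}$$ is zero. -/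

import Mathlib

open CategoryTheory AlgebraicGeometry

universe u v

/-- The `k`-algebra structure on the ring of regular functions `𝒪(X) = Γ(X, ⊤)` of a `k`-scheme
`X`: the structure map `k = 𝒪(Spec k) → 𝒪(X)` is pull-back of functions along `X ⟶ Spec k`. -/
noncomputable instance instAlgebraRegularFunctions (k : Type u) [Field k] (X : Scheme.{u})
    [X.Over (Spec (CommRingCat.of k))] : Algebra k Γ(X, ⊤) :=
  ((Scheme.ΓSpecIso (CommRingCat.of k)).inv ≫
    (X ↘ Spec (CommRingCat.of k)).appTop).hom.toAlgebra

/-- `M` is an `𝒜𝒱` module, where `𝒱 = Der_k(𝒜)`: it is an `𝒜`-module and a module over the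
`k`-Lie algebra `𝒱` on the same `k`-vector space, and the two actions satisfy the Leibniz rule
`η (f m) = f (η m) + η(f) m`. -/
class IsAVModule (k : Type*) (A : Type*) (M : Type*) [CommRing k] [CommRing A] [Algebra k A]
    [AddCommGroup M] [Module k M] [Module A M] [IsScalarTower k A M]
    [LieRingModule (Derivation k A A) M] : Prop
    extends LieModule k (Derivation k A A) M where
  leibniz : ∀ (η : Derivation k A A) (f : A) (m : M), ⁅η, f • m⁆ = f • ⁅η, m⁆ + η f • m

/-! The torsion submodule is stable under vector fields, so its annihilator `I` is an ideal stable
under all derivations, nonzero by finiteness. If `I` were proper, it would lie in the maximal ideal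
`m` of a rational point. Smoothness gives an Euler field `E ∈ m • Der` acting as `n` on `m ^ n / m ^
(n + 1)`. If `I ≤ m ^ n`, then `E f ∈ m * I ≤ m ^ (n + 1)` for `f ∈ I`, while `E f ≡ n f`; dividing
by `n` gives `I ≤ m ^ (n + 1)`. Krull's intersection theorem then forces `I = 0`. Hence `I = A`. -/

/-- The differential at a rational point `p`, sending `a` to the class of `a - a(p)` in the
cotangent space `𝔪 / 𝔪²` at `p`. -/
noncomputable def AlgHom.cotangentDerivation {k A : Type*} [CommRing k] [CommRing A] [Algebra k A]
    (p : A →ₐ[k] k) : Derivation k A (RingHom.ker p).Cotangent :=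
  Derivation.mk'
    { toFun a := (RingHom.ker p).toCotangent ⟨a - algebraMap k A (p a), by simp [RingHom.mem_ker]⟩
      map_add' a b := by
        rw [← map_add]
        congr 1
        ext
        simp
        ring
      map_smul' c a := by
        rw [RingHom.id_apply, ← LinearMap.map_smul_of_tower]
        congr 1
        ext
        simp [Algebra.smul_def, mul_sub] }
    fun a b ↦ by
      simp only [LinearMap.coe_mk, AddHom.coe_mk]
      rw [← map_smul, ← map_smul, ← map_add, Ideal.toCotangent_eq]
      have h (x : A) : x - algebraMap k A (p x) ∈ RingHom.ker p := by simp [RingHom.mem_ker]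
      have := neg_mem (Ideal.mul_mem_mul (h a) (h b))
      rw [← sq] at this
      convert this using 1
      simp
      ring

lemma AlgHom.cotangentDerivation_apply_of_mem {k A : Type*} [CommRing k] [CommRing A]
    [Algebra k A] (p : A →ₐ[k] k) (a : RingHom.ker p) :
    p.cotangentDerivation a = (RingHom.ker p).toCotangent a := by
  have ha : p a = 0 := a.2
  change (RingHom.ker p).toCotangent _ = _
  congr 1
  ext
  simp [ha]

/-- A linear map from a finite projective module `P` to `R` with values in an ideal `J` lies in
`J • Hom(P, R)`. -/
lemma LinearMap.mem_smul_top_of_forall_mem {R P : Type*} [CommRing R] [AddCommGroup P]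
    [Module R P] [Module.Finite R P] [Module.Projective R P] (J : Ideal R) (h : P →ₗ[R] R)
    (hJ : ∀ x, h x ∈ J) : h ∈ J • (⊤ : Submodule R (P →ₗ[R] R)) := by
  obtain ⟨n, f, g, -, -, hfg⟩ := Module.Finite.exists_comp_eq_id_of_projective R P
  have key : h = ∑ i, h (f (Pi.single i 1)) • (LinearMap.proj i ∘ₗ g) := by
    ext x
    have hx : f (g x) = x := LinearMap.congr_fun hfg x
    conv_lhs => rw [← hx, pi_eq_sum_univ' (g x)]
    simp [mul_comm]
  rw [key]
  exact Submodule.sum_mem _ fun i _ ↦ Submodule.smul_mem_smul (hJ _) trivial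

/-- Near a rational point of a smooth algebra there is an Euler vector field: it vanishes at the
point and induces the identity on the cotangent space there. -/
lemma exists_euler_derivation {k A : Type*} [CommRing k] [CommRing A] [Algebra k A]
    [Module.Finite A Ω[A⁄k]] [Module.Projective A Ω[A⁄k]] (p : A →ₐ[k] k) :
    ∃ E ∈ RingHom.ker p • (⊤ : Submodule A (Derivation k A A)),
      ∀ y ∈ RingHom.ker p, E y - y ∈ RingHom.ker p ^ 2 := by
  -- Projectivity of `Ω` lifts the differential at `p` through `m → m / m²`; the lift `h`, read as a
  -- derivation, is the Euler field.
  obtain ⟨h, hh⟩ := Module.projective_lifting_property (RingHom.ker p).toCotangent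
    p.cotangentDerivation.liftKaehlerDifferential (RingHom.ker p).toCotangent_surjective
  have hmem := LinearMap.mem_smul_top_of_forall_mem (RingHom.ker p)
    ((RingHom.ker p).subtype ∘ₗ h) fun x ↦ (h x).2
  refine ⟨(KaehlerDifferential.linearMapEquivDerivation k A)
    ((RingHom.ker p).subtype ∘ₗ h), ?_, fun y hy ↦ ?_⟩
  · have := Submodule.mem_map_of_mem
      (f := (KaehlerDifferential.linearMapEquivDerivation k A (M := A)).toLinearMap) hmem
    rw [Submodule.map_smul''] at this
    exact Submodule.smul_mono le_rfl le_top this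
  · have h1 := LinearMap.congr_fun hh (KaehlerDifferential.D k A y)
    rw [LinearMap.comp_apply, Derivation.liftKaehlerDifferential_comp_D,
      p.cotangentDerivation_apply_of_mem ⟨y, hy⟩, Ideal.toCotangent_eq] at h1
    exact h1

/-- A derivation inducing the identity on `J / J²` acts on `J ^ n / J ^ (n + 1)` as
multiplication by `n`. -/
lemma Derivation.apply_sub_nsmul_mem_pow_succ {k A : Type*} [CommRing k] [CommRing A]
    [Algebra k A] (J : Ideal A) (E : Derivation k A A) (hE : ∀ a, E a ∈ J)
    (hJ : ∀ y ∈ J, E y - y ∈ J ^ 2) (n : ℕ) :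
    ∀ y ∈ J ^ n, E y - n • y ∈ J ^ (n + 1) := by
  induction n with
  | zero => simpa using hE
  | succ n ih =>
    intro y hy
    rw [pow_succ] at hy
    induction hy using Submodule.mul_induction_on' with
    | mem_mul_mem a ha b hb =>
      have h1 := Ideal.mul_mem_mul (ih a ha) hb
      have h2 := Ideal.mul_mem_mul ha (hJ b hb)
      rw [← pow_succ] at h1
      rw [← pow_add] at h2
      convert add_mem h1 h2 using 1
      simp only [Derivation.leibniz, smul_eq_mul, nsmul_eq_mul]
      push_cast
      ring
    | add a _ b _ ha hb =>
      convert add_mem ha hb using 1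
      rw [map_add, smul_add]
      abel

/-- The extra factor `J` is what raises the order of vanishing. -/
lemma Derivation.apply_mem_mul_of_mem_smul_top {k A : Type*} [CommRing k] [CommRing A]
    [Algebra k A] {I J : Ideal A} (hI : ∀ (D : Derivation k A A), ∀ f ∈ I, D f ∈ I)
    {E : Derivation k A A} (hE : E ∈ J • (⊤ : Submodule A (Derivation k A A))) {f : A}
    (hf : f ∈ I) : E f ∈ J * I := by
  induction hE using Submodule.smul_induction_on' with
  | smul a ha D _ => exact Ideal.mul_mem_mul ha (hI D f hf)
  | add D _ D' _ h h' => exact add_mem h h'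

/-- An ideal invariant under all derivations and vanishing at a rational point vanishes there to
infinite order. -/
lemma Ideal.le_ker_pow_of_derivation_invariant {k A : Type*} [Field k] [CharZero k] [CommRing A]
    [Algebra k A] [Module.Finite A Ω[A⁄k]] [Module.Projective A Ω[A⁄k]] (p : A →ₐ[k] k)
    {I : Ideal A} (hI : ∀ (D : Derivation k A A), ∀ f ∈ I, D f ∈ I) (hp : I ≤ RingHom.ker p)
    (n : ℕ) : I ≤ RingHom.ker p ^ n := by
  obtain ⟨E, hE, hE'⟩ := exists_euler_derivation p
  have hEmem (a : A) : E a ∈ RingHom.ker p := by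
    simpa using Derivation.apply_mem_mul_of_mem_smul_top (I := ⊤) (by simp) hE
      (Submodule.mem_top (x := a))
  induction n with
  | zero => simp
  | succ n ih =>
    -- Division by `n` fails at `n = 0`, where `hp` is used instead.
    rcases Nat.eq_zero_or_pos n with rfl | hn
    · simpa using hp
    intro f hf
    have h1 := Derivation.apply_sub_nsmul_mem_pow_succ _ E hEmem hE' n f (ih hf)
    have h2 : E f ∈ RingHom.ker p ^ (n + 1) := by
      rw [pow_succ']
      exact Ideal.mul_mono_right ih (Derivation.apply_mem_mul_of_mem_smul_top hI hE hf)
    have h3 : n • f ∈ RingHom.ker p ^ (n + 1) := by simpa using sub_mem h2 h1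
    rw [← Nat.cast_smul_eq_nsmul k] at h3
    have hn' : (n : k) ≠ 0 := by exact_mod_cast hn.ne'
    simpa [smul_smul, hn'] using Submodule.smul_of_tower_mem _ ((n : k)⁻¹) h3

/-- Weak Nullstellensatz: a maximal ideal of a finite type algebra over an algebraically closed
field is the kernel of a rational point. -/
lemma Ideal.IsMaximal.exists_ker_eq {k A : Type*} [Field k] [IsAlgClosed k] [CommRing A]
    [Algebra k A] [Algebra.FiniteType k A] (m : Ideal A) [m.IsMaximal] :
    ∃ p : A →ₐ[k] k, RingHom.ker p = m := by
  let _ : Field (A ⧸ m) := Ideal.Quotient.field m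
  have : Module.Finite k (A ⧸ m) := finite_of_finite_type_of_isJacobsonRing k (A ⧸ m)
  let e : k ≃ₐ[k] (A ⧸ m) := AlgEquiv.ofBijective (Algebra.ofId k (A ⧸ m))
    IsAlgClosed.algebraMap_bijective_of_isIntegral
  refine ⟨e.symm.toAlgHom.comp (Ideal.Quotient.mkₐ k m), ?_⟩
  ext x
  simp [RingHom.mem_ker, Ideal.Quotient.eq_zero_iff_mem]

/-- A smooth domain over an algebraically closed field of characteristic zero has no proper
nonzero ideal invariant under all derivations. -/
lemma Ideal.eq_top_of_derivation_invariant {k A : Type*} [Field k] [IsAlgClosed k] [CharZero k]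
    [CommRing A] [IsDomain A] [Algebra k A] [Algebra.FiniteType k A]
    [Module.Projective A Ω[A⁄k]] {I : Ideal A}
    (hI : ∀ (D : Derivation k A A), ∀ f ∈ I, D f ∈ I) (h0 : I ≠ ⊥) : I = ⊤ := by
  by_contra htop
  obtain ⟨m, hm, hIm⟩ := Ideal.exists_le_maximal I htop
  obtain ⟨p, rfl⟩ := Ideal.IsMaximal.exists_ker_eq (k := k) m
  have : IsNoetherianRing A := Algebra.FiniteType.isNoetherianRing k A
  refine h0 (le_bot_iff.mp ?_)
  rw [← Ideal.iInf_pow_eq_bot_of_isDomain _ hm.ne_top]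
  exact le_iInf (Ideal.le_ker_pow_of_derivation_invariant p hI hIm)

lemma IsAVModule.lie_mem_torsion {k A M : Type*} [CommRing k] [CommRing A] [Algebra k A]
    [AddCommGroup M] [Module k M] [Module A M] [IsScalarTower k A M]
    [LieRingModule (Derivation k A A) M] [IsAVModule k A M] (η : Derivation k A A) {m : M}
    (hm : m ∈ Submodule.torsion A M) : ⁅η, m⁆ ∈ Submodule.torsion A M := by
  obtain ⟨f, hf⟩ := (Submodule.mem_torsion_iff m).mp hm
  -- Applying `η` to `f m = 0` leaves the term `η(f) m`, which a second factor `f` kills.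
  refine (Submodule.mem_torsion_iff _).mpr ⟨f * f, ?_⟩
  replace hf : (f : A) • m = 0 := hf
  have h := IsAVModule.leibniz (k := k) η (f : A) m
  rw [hf, lie_zero] at h
  have h' := congrArg ((f : A) • ·) h
  simp only [smul_zero, smul_add, smul_comm (f : A) (η (f : A)) m, hf, add_zero] at h'
  change ((f : A) * (f : A)) • ⁅η, m⁆ = 0
  rw [mul_smul, ← h']

lemma IsAVModule.apply_mem_annihilator_torsion {k A M : Type*} [CommRing k] [CommRing A]
    [Algebra k A] [AddCommGroup M] [Module k M] [Module A M] [IsScalarTower k A M]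
    [LieRingModule (Derivation k A A) M] [IsAVModule k A M] (η : Derivation k A A) (f : A)
    (hf : f ∈ (Submodule.torsion A M).annihilator) :
    η f ∈ (Submodule.torsion A M).annihilator := by
  rw [Submodule.mem_annihilator] at hf ⊢
  intro m hm
  have h := IsAVModule.leibniz (k := k) η f m
  rw [hf m hm, lie_zero, hf _ (lie_mem_torsion η hm), zero_add] at h
  exact h.symm

/-- Over a smooth domain, an `𝒜𝒱` module which is finite over `𝒜` is torsion-free. -/
lemma IsAVModule.torsion_eq_bot {k A M : Type*} [Field k] [IsAlgClosed k] [CharZero k]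
    [CommRing A] [IsDomain A] [Algebra k A] [Algebra.FiniteType k A]
    [Module.Projective A Ω[A⁄k]] [AddCommGroup M] [Module k M] [Module A M]
    [IsScalarTower k A M] [LieRingModule (Derivation k A A) M] [IsAVModule k A M]
    [Module.Finite A M] : Submodule.torsion A M = ⊥ := by
  have : IsNoetherianRing A := Algebra.FiniteType.isNoetherianRing k A
  have hne : (Submodule.torsion A M).annihilator ≠ ⊥ := by
    intro hbot
    -- The torsion submodule is finitely generated since `A` is Noetherian, so one nonzero `a` kills
    -- all of it.
    obtain ⟨a, ha, ha'⟩ := Submodule.annihilator_top_inter_nonZeroDivisors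
      (Submodule.torsion_isTorsion (R := A) (M := M))
    rw [SetLike.mem_coe, Submodule.annihilator_top] at ha
    exact nonZeroDivisors.ne_zero ha' (hbot.le ha)
  have htop := Ideal.eq_top_of_derivation_invariant (k := k)
    (fun η f hf ↦ IsAVModule.apply_mem_annihilator_torsion (M := M) η f hf) hne
  exact Submodule.annihilator_eq_top_iff.mp htop

/-- The ring of functions of a smooth affine `k`-scheme is a smooth `k`-algebra. -/
lemma smooth_regularFunctions (k : Type u) [Field k] (X : Scheme.{u})
    [X.Over (Spec (CommRingCat.of k))] [IsAffine X] [Smooth (X ↘ Spec (CommRingCat.of k))] :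
    Algebra.Smooth k Γ(X, ⊤) := by
  have h : (X ↘ Spec (CommRingCat.of k)).appTop.hom.Smooth :=
    (HasRingHomProperty.iff_of_isAffine (P := @Smooth)).mp ‹_›
  have h' := (RingHom.Smooth.of_bijective
    (ConcreteCategory.bijective_of_isIso (Scheme.ΓSpecIso (CommRingCat.of k)).inv)).comp h
  exact h'

/-- An `𝒜𝒱` module over an irreducible smooth affine variety which is finitely generated over
`𝒜 = 𝒪(X)` has no `𝒜`-torsion. -/
theorem lemma4p2 (k : Type u) [Field k] [IsAlgClosed k] [CharZero k]
    (X : Scheme.{u}) [X.Over (Spec (CommRingCat.of k))] [IsAffine X] [IsIntegral X]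
    [Smooth (X ↘ Spec (CommRingCat.of k))]
    (M : Type v) [AddCommGroup M] [Module k M] [Module Γ(X, ⊤) M] [IsScalarTower k Γ(X, ⊤) M]
    [LieRingModule (Derivation k Γ(X, ⊤) Γ(X, ⊤)) M] [IsAVModule k Γ(X, ⊤) M]
    [Module.Finite Γ(X, ⊤) M] :
    Submodule.torsion Γ(X, ⊤) M = ⊥ := by
  have := smooth_regularFunctions k X
  exact IsAVModule.torsion_eq_bot (k := k)
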